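/- For $n\ge 1$, consider the Young diagram of the shifted staircase shape $(2n-1,2n-3,\ldots,3,1)$, i.e. the set of cells $(i,j)\in\mathbb Z^2$ (row $i$, column $j$) with $1\le i\le n$ and $i\le j\le 2n-i$. A standard Young tableau of this shape is a bijective labelling of its $n^2$ cells by $1,2,\ldots,n^2$ that increases strictly from left to right along each row and from top to bottom down each column. Let $T$ be chosen uniformly at random among these tableaux, and let $(n-S,n+S)$ be the cell of $T$ that contains the maximal label $n^2$ (this label always lies in a cell of the form $(i,2n-i)$). Then, for all real numbers $0\le a\le b\le 1$, \[ \lim_{n\to\infty}\mathbb P\left(a\le \frac{S}{n}\le b\right)=\int_a^b\frac{4}{\pi}\sqrt{1-x^2}\,dx , \] that is, $S/n$ converges in distribution to the quarter-circle law on $[0,1]$. -/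

import Mathlib

/-- The Young diagram of the shifted shape `(lam 1, …, lam n)`: the cells `(i, j)` with
`1 ≤ i ≤ n` and `i ≤ j < lam i + i`. -/
def shiftedDiagram (n : ℕ) (lam : ℕ → ℕ) : Finset (ℕ × ℕ) :=
  (Finset.Icc 1 n).biUnion fun i => (Finset.Ico i (lam i + i)).image (Prod.mk i)

/-- The Young diagram of the shifted staircase shape `(2n-1, 2n-3, …, 3, 1)`. -/
def shiftedStaircase (n : ℕ) : Finset (ℕ × ℕ) :=
  shiftedDiagram n fun i => 2 * (n - i) + 1

/-- Standard Young tableaux on a finite set `D` of cells `(row, column)`: bijective labellings of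
the cells by `1, …, |D|` that increase strictly along rows and down columns. -/
def StandardTableau (D : Finset (ℕ × ℕ)) : Type :=
  {T : D ≃ Finset.Icc 1 D.card //
    (∀ c d : D, c.1.1 = d.1.1 → c.1.2 < d.1.2 → (T c : ℕ) < T d) ∧
    (∀ c d : D, c.1.2 = d.1.2 → c.1.1 < d.1.1 → (T c : ℕ) < T d)}

/-- Every set of tableaux is an event. -/
instance StandardTableau.instMeasurableSpace (D : Finset (ℕ × ℕ)) :
    MeasurableSpace (StandardTableau D) := ⊤

theorem mem_shiftedStaircase {n : ℕ} {c : ℕ × ℕ} :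
    c ∈ shiftedStaircase n ↔ 1 ≤ c.1 ∧ c.1 ≤ n ∧ c.1 ≤ c.2 ∧ c.2 + c.1 ≤ 2 * n := by
  obtain ⟨i, j⟩ := c
  simp only [shiftedStaircase, shiftedDiagram, Finset.mem_biUnion, Finset.mem_Icc,
    Finset.mem_image, Finset.mem_Ico, Prod.mk.injEq]
  constructor
  · rintro ⟨i', h, j', h', rfl, rfl⟩
    omega
  · intro h
    exact ⟨i, by omega, j, by omega, rfl, rfl⟩

theorem card_shiftedStaircase (n : ℕ) : (shiftedStaircase n).card = n ^ 2 := by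
  unfold shiftedStaircase shiftedDiagram
  rw [Finset.card_biUnion]
  · have h : ∀ i ∈ Finset.Icc 1 n,
        ((Finset.Ico i (2 * (n - i) + 1 + i)).image (Prod.mk i)).card = 2 * (n - i) + 1 := by
      intro i _
      rw [Finset.card_image_of_injective _ (Prod.mk_right_injective i), Nat.card_Ico]
      omega
    rw [Finset.sum_congr rfl h]
    clear h
    have h2 : ∀ m : ℕ, ∑ i ∈ Finset.range m, (2 * i + 1) = m ^ 2 := by
      intro m
      induction m with
      | zero => simp
      | succ m ih => rw [Finset.sum_range_succ, ih]; ring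
    rw [← h2 n]
    refine Finset.sum_nbij' (fun i => n - i) (fun i => n - i) ?_ ?_ ?_ ?_ ?_ <;>
      intro i hi <;> simp only [Finset.mem_Icc, Finset.mem_range] at hi ⊢ <;> omega
  · intro i _ j _ hij
    simp only [Function.onFun]
    rw [Finset.disjoint_left]
    simp only [Finset.mem_image, not_exists, not_and]
    rintro _ ⟨x, -, rfl⟩ y - h
    exact hij (Prod.mk.inj h).1.symm

/-- The cell of `T` that holds the maximal label `n ^ 2`. -/
def maxCell {n : ℕ} (hn : 0 < n) (T : StandardTableau (shiftedStaircase n)) : ℕ × ℕ :=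
  (T.1.symm ⟨n ^ 2, Finset.mem_Icc.2 ⟨Nat.pow_pos hn, (card_shiftedStaircase n).ge⟩⟩).1

/-- The integer `S` such that `(n - S, n + S)` is the cell of `T` that holds the maximal label
`n ^ 2` (see `maxCell_eq`). The value for `n = 0`, where there is no cell, is irrelevant. -/
def maxOffset {n : ℕ} (T : StandardTableau (shiftedStaircase n)) : ℤ :=
  if hn : 0 < n then ((maxCell hn T).2 : ℤ) - n else 0

/-- The cell holding the maximal label is indeed `(n - S, n + S)`. -/
theorem maxCell_eq {n : ℕ} (hn : 0 < n) (T : StandardTableau (shiftedStaircase n)) :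
    ((maxCell hn T).1 : ℤ) = n - maxOffset T ∧ ((maxCell hn T).2 : ℤ) = n + maxOffset T := by
  have hm : maxCell hn T ∈ shiftedStaircase n := Subtype.property _
  have hT : (T.1 ⟨maxCell hn T, hm⟩ : ℕ) = n ^ 2 := by
    simp [maxCell]
  have hm' := mem_shiftedStaircase.1 hm
  have key : (maxCell hn T).2 + (maxCell hn T).1 = 2 * n := by
    by_contra hne
    have hd : ((maxCell hn T).1, (maxCell hn T).2 + 1) ∈ shiftedStaircase n :=
      mem_shiftedStaircase.2 ⟨hm'.1, hm'.2.1, by simp only; omega, by simp only; omega⟩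
    have h1 := T.2.1 ⟨_, hm⟩ ⟨_, hd⟩ rfl (Nat.lt_succ_self _)
    have h2 := (Finset.mem_Icc.1 (T.1 ⟨_, hd⟩).2).2
    have h3 := card_shiftedStaircase n
    omega
  simp only [maxOffset, dif_pos hn]
  omega

/-! Deleting the maximal label leaves a tableau of a smaller shifted shape, so tableau counts
satisfy a recursion over corners. Schur's product formula `N! / ∏ λᵢ! * ∏ |λᵢ - λⱼ| / (λᵢ + λⱼ)`
solves it: the ratio of two neighbouring values is a rational function of the parts, and the
recursion becomes the partial fraction identity `sum_rowWeight`. Hence row `i` holds the maximum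
with probability exactly `rowWeight / N`.

For the parts `1, 3, …, 2n - 1` this weight factors into Wallis ratios (`rowWeight_odd`). Sharp
bounds on these give `P(S = k) ≤ (f(k/n) + O(n^(-1/2))) / n`, where `f` is the quarter-circle
density.

Only this upper bound is needed. A Riemann sum turns it into an upper bound for the probability of
any interval (`offsetProb_le`). Since `f` has total mass 1, the upper bounds on `[0, a]` and `[b,
1]` force the matching lower bound on `[a, b]` (`le_offsetProb`). -/

/-! ### Labellings and removal of the maximal label -/

/-- Standard labellings of `D`, extended by `0` outside `D`. -/
def labellings (D : Finset (ℕ × ℕ)) : Set (ℕ × ℕ → ℕ) :=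
  {f | (∀ c ∉ D, f c = 0) ∧ (∀ c ∈ D, f c ∈ Finset.Icc 1 D.card) ∧ Set.InjOn f D ∧
    (∀ c ∈ D, ∀ d ∈ D, c.1 = d.1 → c.2 < d.2 → f c < f d) ∧
    (∀ c ∈ D, ∀ d ∈ D, c.2 = d.2 → c.1 < d.1 → f c < f d)}

/-- The labelling of `D` given by a standard tableau. -/
def StandardTableau.toFun {D : Finset (ℕ × ℕ)} (T : StandardTableau D) (c : ℕ × ℕ) : ℕ :=
  if h : c ∈ D then (T.1 ⟨c, h⟩ : ℕ) else 0

theorem StandardTableau.toFun_of_mem {D : Finset (ℕ × ℕ)} (T : StandardTableau D) {c : ℕ × ℕ}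
    (h : c ∈ D) : T.toFun c = T.1 ⟨c, h⟩ := dif_pos h

theorem StandardTableau.toFun_injective {D : Finset (ℕ × ℕ)} :
    Function.Injective (StandardTableau.toFun (D := D)) := by
  intro T T' h
  refine Subtype.ext (Equiv.ext fun c => Subtype.ext ?_)
  have := congrFun h c.1
  rwa [toFun_of_mem _ c.2, toFun_of_mem _ c.2] at this

theorem StandardTableau.range_toFun {D : Finset (ℕ × ℕ)} :
    Set.range (StandardTableau.toFun (D := D)) = labellings D := by
  ext f
  constructor
  · rintro ⟨T, rfl⟩
    refine ⟨fun c hc => dif_neg hc, fun c hc => ?_, fun c hc d hd h => ?_,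
      fun c hc d hd h h' => ?_, fun c hc d hd h h' => ?_⟩
    · rw [toFun_of_mem _ hc]
      exact (T.1 ⟨c, hc⟩).2
    · rw [toFun_of_mem _ hc, toFun_of_mem _ hd] at h
      exact congrArg Subtype.val (T.1.injective (Subtype.ext h))
    · rw [toFun_of_mem _ hc, toFun_of_mem _ hd]
      exact T.2.1 ⟨c, hc⟩ ⟨d, hd⟩ h h'
    · rw [toFun_of_mem _ hc, toFun_of_mem _ hd]
      exact T.2.2 ⟨c, hc⟩ ⟨d, hd⟩ h h'
  · rintro ⟨h0, hm, hi, hr, hc⟩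
    let g : D → Finset.Icc 1 D.card := fun c => ⟨f c.1, hm c.1 c.2⟩
    have hg : Function.Injective g := fun c d h =>
      Subtype.ext (hi c.2 d.2 (congrArg Subtype.val h))
    have hb : Function.Bijective g :=
      (Fintype.bijective_iff_injective_and_card g).2 ⟨hg, by simp⟩
    refine ⟨⟨Equiv.ofBijective g hb, fun c d => hr c.1 c.2 d.1 d.2,
      fun c d => hc c.1 c.2 d.1 d.2⟩, funext fun c => ?_⟩
    by_cases h : c ∈ D
    · exact (toFun_of_mem _ h).trans rfl
    · rw [h0 c h]
      exact dif_neg h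

instance StandardTableau.instFinite (D : Finset (ℕ × ℕ)) : Finite (StandardTableau D) :=
  inferInstanceAs (Finite {_T : D ≃ Finset.Icc 1 D.card // _})

theorem labellings_finite (D : Finset (ℕ × ℕ)) : (labellings D).Finite := by
  rw [← StandardTableau.range_toFun]
  exact Set.finite_range _

/-- The labellings of `D` whose maximal label is in the cell `c`. -/
def labellingsMaxAt (D : Finset (ℕ × ℕ)) (c : ℕ × ℕ) : Set (ℕ × ℕ → ℕ) :=
  {f ∈ labellings D | f c = D.card}

theorem exists_eq_card {D : Finset (ℕ × ℕ)} (hD : D.Nonempty) {f : ℕ × ℕ → ℕ}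
    (hf : f ∈ labellings D) : ∃ c ∈ D, f c = D.card := by
  obtain ⟨-, hm, hi, -, -⟩ := hf
  have h := Finset.surj_on_of_inj_on_of_card_le (s := D) (t := Finset.Icc 1 D.card)
    (fun c _ => f c) hm (fun c d hc hd h => hi hc hd h) (by simp) D.card
    (Finset.mem_Icc.2 ⟨hD.card_pos, le_rfl⟩)
  obtain ⟨c, hc, h⟩ := h
  exact ⟨c, hc, h.symm⟩

theorem ncard_labellings {D : Finset (ℕ × ℕ)} (hD : D.Nonempty) :
    (labellings D).ncard = ∑ c ∈ D, (labellingsMaxAt D c).ncard := by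
  classical
  have hfin : ∀ c, (labellingsMaxAt D c).Finite := fun c =>
    (labellings_finite D).subset (Set.sep_subset _ _)
  have hU : (labellings_finite D).toFinset = D.biUnion fun c => (hfin c).toFinset := by
    ext f
    simp only [Set.Finite.mem_toFinset, Finset.mem_biUnion]
    constructor
    · intro hf
      obtain ⟨c, hc, h⟩ := exists_eq_card hD hf
      exact ⟨c, hc, hf, h⟩
    · rintro ⟨c, -, hf⟩
      exact hf.1
  rw [Set.ncard_eq_toFinset_card _ (labellings_finite D), hU]
  rw [Finset.card_biUnion]
  · exact Finset.sum_congr rfl fun c _ => (Set.ncard_eq_toFinset_card _ (hfin c)).symm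
  · intro c hc d hd hcd
    simp only [Function.onFun]
    rw [Finset.disjoint_left]
    intro f hf hf'
    simp only [Set.Finite.mem_toFinset] at hf hf'
    exact hcd (hf.1.2.2.1 hc hd (hf.2.trans hf'.2.symm))

theorem labellingsMaxAt_eq_empty {D : Finset (ℕ × ℕ)} {c d : ℕ × ℕ} (hc : c ∈ D) (hd : d ∈ D)
    (h : (c.1 = d.1 ∧ c.2 < d.2) ∨ (c.2 = d.2 ∧ c.1 < d.1)) : labellingsMaxAt D c = ∅ := by
  rw [Set.eq_empty_iff_forall_notMem]
  rintro f ⟨⟨-, hm, -, hr, hcol⟩, hmax⟩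
  have h1 : f c < f d := by
    rcases h with h | h
    · exact hr c hc d hd h.1 h.2
    · exact hcol c hc d hd h.1 h.2
  have h2 := Finset.mem_Icc.1 (hm d hd)
  omega

/-- Erasing the maximal label is a bijection. Its inverse puts the label back, and monotonicity
survives because no cell of `D` lies to the right of `c` in its row or below it in its column. -/
theorem ncard_labellingsMaxAt_of_corner {D : Finset (ℕ × ℕ)} {c : ℕ × ℕ} (hc : c ∈ D)
    (hr : ∀ d ∈ D, c.1 = d.1 → d.2 ≤ c.2) (hcol : ∀ d ∈ D, c.2 = d.2 → d.1 ≤ c.1) :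
    (labellingsMaxAt D c).ncard = (labellings (D.erase c)).ncard := by
  have hcard := Finset.card_erase_add_one hc
  refine Set.ncard_congr (fun f _ => Function.update f c 0) ?_ ?_ ?_
  · rintro f ⟨⟨h0, hm, hi, hrow, hco⟩, hmax⟩
    have hup : ∀ d ∈ D.erase c, Function.update f c 0 d = f d := fun d hd =>
      Function.update_of_ne (Finset.mem_erase.1 hd).1 _ _
    refine ⟨fun d hd => ?_, fun d hd => ?_, fun d hd e he h => ?_, fun d hd e he => ?_,
      fun d hd e he => ?_⟩
    · by_cases hdc : d = c
      · simp [hdc]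
      · rw [Function.update_of_ne hdc]
        exact h0 d fun h => hd (Finset.mem_erase.2 ⟨hdc, h⟩)
    · rw [hup d hd]
      have hd' := Finset.mem_erase.1 hd
      have h1 := Finset.mem_Icc.1 (hm d hd'.2)
      have h2 : f d ≠ D.card := fun h => hd'.1 (hi hd'.2 hc (h.trans hmax.symm))
      rw [Finset.mem_Icc]
      omega
    · rw [hup d hd, hup e he] at h
      exact hi (Finset.mem_erase.1 hd).2 (Finset.mem_erase.1 he).2 h
    · rw [hup d hd, hup e he]
      exact hrow d (Finset.mem_erase.1 hd).2 e (Finset.mem_erase.1 he).2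
    · rw [hup d hd, hup e he]
      exact hco d (Finset.mem_erase.1 hd).2 e (Finset.mem_erase.1 he).2
  · rintro f g ⟨-, hf⟩ ⟨-, hg⟩ h
    funext d
    by_cases hdc : d = c
    · rw [hdc, hf, hg]
    · simpa [Function.update_of_ne hdc] using congrFun h d
  · rintro g ⟨h0, hm, hi, hrow, hco⟩
    have hup : ∀ d, d ≠ c → Function.update g c D.card d = g d := fun d hd =>
      Function.update_of_ne hd _ _
    have hlt : ∀ d ∈ D, d ≠ c → g d < D.card := fun d hd hdc => by
      have := Finset.mem_Icc.1 (hm d (Finset.mem_erase.2 ⟨hdc, hd⟩))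
      omega
    refine ⟨Function.update g c D.card, ⟨⟨fun d hd => ?_, fun d hd => ?_, fun d hd e he h => ?_,
      fun d hd e he h h' => ?_, fun d hd e he h h' => ?_⟩, by simp⟩, ?_⟩
    · rw [hup d fun h => hd (h ▸ hc)]
      exact h0 d fun h => hd (Finset.mem_erase.1 h).2
    · by_cases hdc : d = c
      · rw [hdc, Function.update_self, Finset.mem_Icc]
        omega
      · rw [hup d hdc]
        have := Finset.mem_Icc.1 (hm d (Finset.mem_erase.2 ⟨hdc, hd⟩))
        rw [Finset.mem_Icc]
        omega
    · by_cases hdc : d = c <;> by_cases hec : e = c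
      · rw [hdc, hec]
      · rw [hdc, Function.update_self, hup e hec] at h
        exact absurd h (hlt e he hec).ne'
      · rw [hec, Function.update_self, hup d hdc] at h
        exact absurd h (hlt d hd hdc).ne
      · rw [hup d hdc, hup e hec] at h
        exact hi (Finset.mem_erase.2 ⟨hdc, hd⟩) (Finset.mem_erase.2 ⟨hec, he⟩) h
    · have hdc : d ≠ c := by
        rintro rfl
        exact absurd (hr e he h) (by omega)
      rw [hup d hdc]
      by_cases hec : e = c
      · rw [hec, Function.update_self]
        exact hlt d hd hdc
      · rw [hup e hec]
        exact hrow d (Finset.mem_erase.2 ⟨hdc, hd⟩) e (Finset.mem_erase.2 ⟨hec, he⟩) h h'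
    · have hdc : d ≠ c := by
        rintro rfl
        exact absurd (hcol e he h) (by omega)
      rw [hup d hdc]
      by_cases hec : e = c
      · rw [hec, Function.update_self]
        exact hlt d hd hdc
      · rw [hup e hec]
        exact hco d (Finset.mem_erase.2 ⟨hdc, hd⟩) e (Finset.mem_erase.2 ⟨hec, he⟩) h h'
    · funext d
      by_cases hdc : d = c
      · rw [hdc, Function.update_self, h0 c (Finset.notMem_erase c D)]
      · simp [Function.update_of_ne hdc]

/-! ### The product formula and its partial fraction identity -/

/-- The product of `|x i - x j| / (x i + x j)` over the pairs `i < j` in `s`. -/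
noncomputable def pairProd (s : Finset ℕ) (x : ℕ → ℝ) : ℝ :=
  ∏ i ∈ s, ∏ j ∈ s, if i < j then |x i - x j| / (x i + x j) else 1

/-- The absolute value makes each factor symmetric in its two indices, so the position of `a`
relative to `s` does not matter. -/
theorem pairProd_insert {s : Finset ℕ} {a : ℕ} (ha : a ∉ s) (x : ℕ → ℝ) :
    pairProd (insert a s) x = pairProd s x * ∏ j ∈ s, |x a - x j| / (x a + x j) := by
  simp only [pairProd, Finset.prod_insert ha, lt_irrefl, if_false, one_mul,
    Finset.prod_mul_distrib]
  rw [← mul_assoc, mul_comm, ← Finset.prod_mul_distrib]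
  congr 1
  refine Finset.prod_congr rfl fun j hj => ?_
  rcases lt_trichotomy a j with h | h | h
  · rw [if_pos h, if_neg h.not_gt, mul_one]
  · exact absurd (h ▸ hj) ha
  · rw [if_pos h, if_neg h.not_gt, one_mul, abs_sub_comm, add_comm]

theorem pairProd_congr {s : Finset ℕ} {x y : ℕ → ℝ} (h : ∀ i ∈ s, x i = y i) :
    pairProd s x = pairProd s y :=
  Finset.prod_congr rfl fun i hi => Finset.prod_congr rfl fun j hj => by rw [h i hi, h j hj]

open Polynomial in
/-- Comparison of the coefficients of `1 / X` at infinity in the partial fraction expansion of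
`∏ (X - a i) / (X - b i)`. -/
theorem sum_prod_div_eq_sum_sub {ι : Type*} [DecidableEq ι] (s : Finset ι) (a b : ι → ℝ)
    (hb : Set.InjOn b s) :
    ∑ i ∈ s, (b i - a i) * ∏ j ∈ s.erase i, (b i - a j) / (b i - b j) =
      ∑ i ∈ s, (b i - a i) := by
  rcases s.eq_empty_or_nonempty with rfl | hs
  · simp
  have hA : (∏ i ∈ s, (X - C (a i))).Monic := monic_prod_of_monic _ _ fun i _ => monic_X_sub_C _
  have hB : (∏ i ∈ s, (X - C (b i))).Monic := monic_prod_of_monic _ _ fun i _ => monic_X_sub_C _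
  have dA : (∏ i ∈ s, (X - C (a i))).degree = (s.card : WithBot ℕ) := by
    rw [degree_prod]; simp
  have dB : (∏ i ∈ s, (X - C (b i))).degree = (s.card : WithBot ℕ) := by
    rw [degree_prod]; simp
  have hdeg : (∏ i ∈ s, (X - C (a i)) - ∏ i ∈ s, (X - C (b i))).degree < (s.card : WithBot ℕ) := by
    rw [← dA]
    exact degree_sub_lt_left (dA.trans dB.symm) hA.ne_zero (by rw [hA.leadingCoeff, hB.leadingCoeff])
  -- Both products are monic of degree `s.card`, so their difference is recovered by interpolation
  -- at the nodes `b i`, where the second product vanishes. The coefficient of degree `s.card - 1`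
  -- is compared.
  have key := Lagrange.coeff_eq_sum hb hdeg
  rw [coeff_sub, prod_X_sub_C_coeff_card_pred _ _ hs.card_pos,
    prod_X_sub_C_coeff_card_pred _ _ hs.card_pos] at key
  rw [Finset.sum_sub_distrib, ← neg_add_eq_sub, ← sub_neg_eq_add, key]
  refine Finset.sum_congr rfl fun i hi => ?_
  have h0 : ∏ j ∈ s, (b i - b j) = 0 := Finset.prod_eq_zero hi (sub_self _)
  simp only [eval_sub, eval_prod, eval_X, eval_C, h0, sub_zero]
  rw [← Finset.mul_prod_erase s _ hi, Finset.prod_div_distrib, mul_div_assoc]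

/-- The weight of row `i` in the shifted shape with row lengths `x`. -/
noncomputable def rowWeight (s : Finset ℕ) (x : ℕ → ℝ) (i : ℕ) : ℝ :=
  x i * ∏ j ∈ s.erase i, ((x i - 1 - x j) * (x i + x j)) / ((x i - x j) * (x i - 1 + x j))

/-- Take `bᵢ = xᵢ(xᵢ - 1)` and `aᵢ = xᵢ(xᵢ + 1)` in the partial fraction identity. Then `bᵢ - aⱼ =
(xᵢ - 1 - xⱼ)(xᵢ + xⱼ)`, `bᵢ - bⱼ = (xᵢ - xⱼ)(xᵢ - 1 + xⱼ)` and `bᵢ - aᵢ = -2xᵢ`. The bound `1 ≤ xᵢ`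
keeps the nodes distinct. -/
theorem sum_rowWeight {s : Finset ℕ} {x : ℕ → ℝ} (hx : Set.InjOn x s) (h1 : ∀ i ∈ s, 1 ≤ x i) :
    ∑ i ∈ s, rowWeight s x i = ∑ i ∈ s, x i := by
  have hb : Set.InjOn (fun i => x i * (x i - 1)) s := by
    intro i hi j hj h
    have h' : (x i - x j) * (x i + x j - 1) = 0 := by linear_combination h
    rcases mul_eq_zero.1 h' with h' | h'
    · exact hx hi hj (sub_eq_zero.1 h')
    · linarith [h1 i hi, h1 j hj]
  have key := sum_prod_div_eq_sum_sub s (fun i => x i * (x i + 1)) _ hb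
  have e : ∀ i, x i * (x i - 1) - x i * (x i + 1) = -2 * x i := fun i => by ring
  simp only [e] at key
  rw [← Finset.mul_sum] at key
  have key' : -2 * ∑ i ∈ s, rowWeight s x i = -2 * ∑ i ∈ s, x i := by
    rw [← key, Finset.mul_sum]
    refine Finset.sum_congr rfl fun i _ => ?_
    rw [rowWeight, ← mul_assoc]
    congr 1
    refine Finset.prod_congr rfl fun j _ => ?_
    congr 1 <;> ring
  linarith

open Nat in
/-- The product formula for the number of standard tableaux of shifted shape `lam`, see
`ncard_labellings_shiftedDiagram`. -/
noncomputable def shiftedCount (n : ℕ) (lam : ℕ → ℕ) : ℝ :=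
  ((∑ i ∈ Finset.Icc 1 n, lam i)! : ℝ) / (∏ i ∈ Finset.Icc 1 n, ((lam i)! : ℝ)) *
    pairProd (Finset.Icc 1 n) fun i => (lam i : ℝ)

/-- Only the factors involving row `i` change, and their quotient is the row weight. If the
shortened row ties with another one, both sides vanish. -/
theorem shiftedCount_update {n : ℕ} {lam : ℕ → ℕ} (hinj : Set.InjOn lam (Finset.Icc 1 n))
    (hpos : ∀ i ∈ Finset.Icc 1 n, 0 < lam i) {i : ℕ} (hi : i ∈ Finset.Icc 1 n) :
    shiftedCount n (Function.update lam i (lam i - 1)) * (∑ i ∈ Finset.Icc 1 n, lam i : ℕ) =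
      shiftedCount n lam * rowWeight (Finset.Icc 1 n) (fun i => (lam i : ℝ)) i := by
  set s := Finset.Icc 1 n with hs
  set t := s.erase i with ht
  have hit : i ∉ t := Finset.notMem_erase i s
  have hst : insert i t = s := Finset.insert_erase hi
  obtain ⟨m, hm⟩ : ∃ m, lam i = m + 1 := ⟨lam i - 1, by have := hpos i hi; omega⟩
  set mu := Function.update lam i (lam i - 1) with hmu
  have hmui : mu i = m := by simp [hmu, hm]
  have hmut : ∀ j ∈ t, mu j = lam j := fun j hj =>
    Function.update_of_ne (Finset.mem_erase.1 hj).1 _ _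
  have e1 : ∑ j ∈ s, mu j = m + ∑ j ∈ t, lam j := by
    rw [← hst, Finset.sum_insert hit, hmui, Finset.sum_congr rfl hmut]
  have e2 : ∑ j ∈ s, lam j = m + ∑ j ∈ t, lam j + 1 := by
    rw [← hst, Finset.sum_insert hit, hm]; ring
  have e3 : ∏ j ∈ s, ((mu j).factorial : ℝ) = m.factorial * ∏ j ∈ t, ((lam j).factorial : ℝ) := by
    rw [← hst, Finset.prod_insert hit, hmui]
    congr 1
    exact Finset.prod_congr rfl fun j hj => by rw [hmut j hj]
  have e4 : ∏ j ∈ s, ((lam j).factorial : ℝ) =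
      (m + 1).factorial * ∏ j ∈ t, ((lam j).factorial : ℝ) := by
    rw [← hst, Finset.prod_insert hit, hm]
  have e5 : pairProd s (fun j => (mu j : ℝ)) = pairProd t (fun j => (lam j : ℝ)) *
      ∏ j ∈ t, |(m : ℝ) - lam j| / (m + lam j) := by
    rw [← hst, pairProd_insert hit, hmui, pairProd_congr fun j hj => by rw [hmut j hj]]
    congr 1
    exact Finset.prod_congr rfl fun j hj => by rw [hmut j hj]
  have e6 : pairProd s (fun j => (lam j : ℝ)) = pairProd t (fun j => (lam j : ℝ)) *
      ∏ j ∈ t, |(m + 1 : ℝ) - lam j| / (m + 1 + lam j) := by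
    rw [← hst, pairProd_insert hit, hm]
    push_cast
    rfl
  have e7 : ∏ j ∈ t, |(m : ℝ) - lam j| / (m + lam j) =
      (∏ j ∈ t, |(m + 1 : ℝ) - lam j| / (m + 1 + lam j)) *
      ∏ j ∈ t, ((m - lam j) * (m + 1 + lam j)) / ((m + 1 - lam j) * (m + lam j) : ℝ) := by
    rw [← Finset.prod_mul_distrib]
    refine Finset.prod_congr rfl fun j hj => ?_
    have hj' := Finset.mem_erase.1 hj
    have hne : lam j ≠ m + 1 := fun h => hj'.1 (hinj hj'.2 hi (h.trans hm.symm))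
    have hp : (0 : ℝ) < lam j := by exact_mod_cast hpos j hj'.2
    have hm0 : (0 : ℝ) ≤ m := Nat.cast_nonneg m
    have h1 : (m + lam j : ℝ) ≠ 0 := by positivity
    have h2 : (m + 1 + lam j : ℝ) ≠ 0 := by positivity
    -- As `lam j` is an integer other than `m + 1`, the differences `m - lam j` and `m + 1 - lam j`
    -- never have opposite signs, so the absolute values drop out of the ratio.
    rcases lt_or_gt_of_ne hne with h | h
    · have h' : (lam j : ℝ) ≤ m := by exact_mod_cast Nat.lt_succ_iff.1 h
      have h3 : (m + 1 - lam j : ℝ) ≠ 0 := by linarith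
      rw [abs_of_nonneg (by linarith), abs_of_nonneg (by linarith)]
      field_simp
    · have h' : (m + 1 : ℝ) < lam j := by exact_mod_cast h
      have h3 : (m + 1 - lam j : ℝ) ≠ 0 := by linarith
      rw [abs_of_nonpos (by linarith), abs_of_nonpos (by linarith)]
      field_simp
  have e8 : rowWeight s (fun j => (lam j : ℝ)) i = (m + 1) *
      ∏ j ∈ t, ((m - lam j) * (m + 1 + lam j)) / ((m + 1 - lam j) * (m + lam j) : ℝ) := by
    simp only [rowWeight, hm]
    push_cast
    simp only [add_sub_cancel_right, ht]
  have hF : (∏ j ∈ t, ((lam j).factorial : ℝ)) ≠ 0 :=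
    Finset.prod_ne_zero_iff.2 fun j _ => by positivity
  have hm1 : (m.factorial : ℝ) ≠ 0 := by positivity
  rw [shiftedCount, shiftedCount, ← hs, e8, e5, e6, e7, e3, e4, e1, e2, Nat.factorial_succ,
    Nat.factorial_succ]
  generalize (∏ j ∈ t, |(m + 1 : ℝ) - lam j| / (m + 1 + lam j)) = A
  generalize (∏ j ∈ t, ((m - lam j) * (m + 1 + lam j)) /
    ((m + 1 - lam j) * (m + lam j) : ℝ)) = B
  push_cast
  field_simp

/-! ### Counting tableaux of shifted shape -/

theorem mem_shiftedDiagram {n : ℕ} {lam : ℕ → ℕ} {c : ℕ × ℕ} :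
    c ∈ shiftedDiagram n lam ↔ 1 ≤ c.1 ∧ c.1 ≤ n ∧ c.1 ≤ c.2 ∧ c.2 < lam c.1 + c.1 := by
  obtain ⟨i, j⟩ := c
  simp only [shiftedDiagram, Finset.mem_biUnion, Finset.mem_Icc, Finset.mem_image,
    Finset.mem_Ico, Prod.mk.injEq]
  constructor
  · rintro ⟨i', h, j', h', rfl, rfl⟩
    omega
  · intro h
    exact ⟨i, by omega, j, by omega, rfl, rfl⟩

theorem StrictAntiOn.add_id_le {n : ℕ} {lam : ℕ → ℕ} (h : StrictAntiOn lam (Finset.Icc 1 n))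
    {i j : ℕ} (hi : 1 ≤ i) (hij : i ≤ j) (hj : j ≤ n) : lam j + j ≤ lam i + i := by
  induction j, hij using Nat.le_induction with
  | base => exact le_rfl
  | succ k hk ih =>
    have h1 := h (a := k) (b := k + 1) (by simp; omega) (by simp; omega) (Nat.lt_succ_self k)
    have h2 := ih (by omega)
    omega

/-- The last cell of row `i`. -/
def rowEnd (lam : ℕ → ℕ) (i : ℕ) : ℕ × ℕ := (i, lam i + i - 1)

theorem ncard_labellings_eq_sum_rowEnd {n : ℕ} {lam : ℕ → ℕ} (hn : 0 < n)
    (hpos : ∀ i ∈ Finset.Icc 1 n, 0 < lam i) :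
    (labellings (shiftedDiagram n lam)).ncard =
      ∑ i ∈ Finset.Icc 1 n, (labellingsMaxAt (shiftedDiagram n lam) (rowEnd lam i)).ncard := by
  have hmem : ∀ i ∈ Finset.Icc 1 n, rowEnd lam i ∈ shiftedDiagram n lam := by
    intro i hi
    have h1 := hpos i hi
    have h2 := Finset.mem_Icc.1 hi
    rw [mem_shiftedDiagram]
    simp only [rowEnd]
    omega
  have hinj : Set.InjOn (rowEnd lam) (Finset.Icc 1 n) := fun i _ j _ h => (Prod.mk.inj h).1
  rw [ncard_labellings ⟨_, hmem 1 (Finset.mem_Icc.2 ⟨le_rfl, hn⟩)⟩,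
    ← Finset.sum_image (f := fun c => (labellingsMaxAt (shiftedDiagram n lam) c).ncard) hinj]
  symm
  refine Finset.sum_subset ?_ fun c hc hc' => ?_
  · intro c hc
    obtain ⟨i, hi, rfl⟩ := Finset.mem_image.1 hc
    exact hmem i hi
  · have h := mem_shiftedDiagram.1 hc
    have hne : c.2 ≠ lam c.1 + c.1 - 1 := fun h' => hc' (Finset.mem_image.2
      ⟨c.1, Finset.mem_Icc.2 ⟨h.1, h.2.1⟩, Prod.ext rfl h'.symm⟩)
    rw [labellingsMaxAt_eq_empty (d := (c.1, c.2 + 1)) hc, Set.ncard_empty]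
    · rw [mem_shiftedDiagram]
      simp only
      omega
    · exact Or.inl ⟨rfl, Nat.lt_succ_self _⟩

theorem shiftedCount_eq_zero {n : ℕ} {lam : ℕ → ℕ} {i j : ℕ} (hi : i ∈ Finset.Icc 1 n)
    (hj : j ∈ Finset.Icc 1 n) (hij : i < j) (h : lam i = lam j) : shiftedCount n lam = 0 := by
  have h0 : pairProd (Finset.Icc 1 n) (fun i => (lam i : ℝ)) = 0 := by
    refine Finset.prod_eq_zero hi (Finset.prod_eq_zero hj ?_)
    simp only [if_pos hij, h, sub_self, abs_zero, zero_div]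
  rw [shiftedCount, h0, mul_zero]

/-- If the next row is shorter by exactly one, the row end has a cell below it and the shortened
parts tie, so both sides are zero. Otherwise the row end is a corner and its removal gives a smaller
strict shape. The hypothesis `hcount` is the induction hypothesis of the product formula; once that
formula is proved, it can be discharged outright. -/
theorem ncard_labellingsMaxAt_rowEnd {n : ℕ} {lam : ℕ → ℕ}
    (hlam : StrictAntiOn lam (Finset.Icc 1 n)) (hpos : ∀ i ∈ Finset.Icc 1 n, 0 < lam i)
    (hcount : ∀ mu : ℕ → ℕ, StrictAntiOn mu (Finset.Icc 1 n) →
      ∑ i ∈ Finset.Icc 1 n, mu i < ∑ i ∈ Finset.Icc 1 n, lam i →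
      ((labellings (shiftedDiagram n mu)).ncard : ℝ) = shiftedCount n mu)
    {i : ℕ} (hi : i ∈ Finset.Icc 1 n) :
    ((labellingsMaxAt (shiftedDiagram n lam) (rowEnd lam i)).ncard : ℝ) =
      shiftedCount n (Function.update lam i (lam i - 1)) := by
  have hi' := Finset.mem_Icc.1 hi
  have hp := hpos i hi
  have hmem : rowEnd lam i ∈ shiftedDiagram n lam := by
    rw [mem_shiftedDiagram]
    simp only [rowEnd]
    omega
  obtain ⟨mu, hmu⟩ : ∃ mu : ℕ → ℕ, mu = Function.update lam i (lam i - 1) := ⟨_, rfl⟩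
  have hmui : mu i = lam i - 1 := by rw [hmu, Function.update_self]
  have hmune : ∀ j, j ≠ i → mu j = lam j := fun j hj => by rw [hmu, Function.update_of_ne hj]
  rw [← hmu]
  by_cases hcorner : i < n ∧ lam (i + 1) + 1 = lam i
  · have hi1 : i + 1 ∈ Finset.Icc 1 n := Finset.mem_Icc.2 ⟨by omega, hcorner.1⟩
    have hp1 := hpos _ hi1
    rw [labellingsMaxAt_eq_empty (d := (i + 1, lam i + i - 1)) hmem, Set.ncard_empty,
      shiftedCount_eq_zero hi hi1 (Nat.lt_succ_self i), Nat.cast_zero]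
    · rw [hmui, hmune _ (Nat.succ_ne_self i)]
      simp only [Nat.succ_eq_add_one]
      omega
    · rw [mem_shiftedDiagram]
      simp only
      omega
    · exact Or.inr ⟨rfl, Nat.lt_succ_self i⟩
  have hbelow : ∀ j, i < j → j ≤ n → lam j + j + 1 ≤ lam i + i ∧ lam j + 1 < lam i := by
    intro j hij hj
    have h1 := hlam.add_id_le (i := i + 1) (j := j) (by omega) (by omega) hj
    have h2 := hlam (a := i) (b := i + 1) (by simp; omega) (by simp; omega) (Nat.lt_succ_self i)
    have h3 : lam (i + 1) + 1 ≠ lam i := fun h => hcorner ⟨by omega, h⟩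
    omega
  rw [ncard_labellingsMaxAt_of_corner hmem]
  · rw [← hcount]
    · congr 3
      ext c
      rw [Finset.mem_erase, mem_shiftedDiagram, mem_shiftedDiagram, rowEnd, Ne, Prod.ext_iff]
      by_cases hc : c.1 = i
      · simp only [hc, hmui, true_and]
        omega
      · simp only [hmune _ hc, hc]
        tauto
    · intro j hj k hk hjk
      have hj' := Finset.mem_Icc.1 (Finset.mem_coe.1 hj)
      have hk' := Finset.mem_Icc.1 (Finset.mem_coe.1 hk)
      have h := hlam hj hk hjk
      by_cases hji : j = i
      · subst hji
        rw [hmui, hmune _ hjk.ne']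
        have := (hbelow k hjk hk'.2).2
        omega
      · rw [hmune _ hji]
        by_cases hki : k = i
        · subst hki
          rw [hmui]
          omega
        · rwa [hmune _ hki]
    · refine Finset.sum_lt_sum (fun j _ => ?_) ⟨i, hi, ?_⟩
      · by_cases hji : j = i
        · subst hji
          rw [hmui]
          omega
        · rw [hmune _ hji]
      · rw [hmui]
        omega
  · intro d hd h
    have := mem_shiftedDiagram.1 hd
    simp only [rowEnd] at h ⊢
    subst h
    omega
  · intro d hd h
    have hd' := mem_shiftedDiagram.1 hd
    simp only [rowEnd] at h ⊢
    by_contra hlt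
    have := (hbelow d.1 (by omega) hd'.2.1).1
    omega

theorem labellings_empty : labellings ∅ = {0} := by
  ext f
  simp only [labellings, Set.mem_ofPred_eq, Finset.notMem_empty, not_false_eq_true, true_imp_iff,
    false_imp_iff, implies_true, and_true, Finset.coe_empty, Set.injOn_empty,
    Set.mem_singleton_iff, funext_iff, Pi.zero_apply]

theorem shiftedDiagram_succ_of_eq_zero {n : ℕ} {lam : ℕ → ℕ} (h : lam (n + 1) = 0) :
    shiftedDiagram (n + 1) lam = shiftedDiagram n lam := by
  ext c
  rw [mem_shiftedDiagram, mem_shiftedDiagram]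
  by_cases hc : c.1 = n + 1
  · rw [hc, h]
    omega
  · omega

/-- A zero part contributes `0! = 1` and pair factors `λ / λ = 1`; positivity of the other parts
rules out `0 / 0`. -/
theorem shiftedCount_succ_of_eq_zero {n : ℕ} {lam : ℕ → ℕ} (h : lam (n + 1) = 0)
    (hpos : ∀ i ∈ Finset.Icc 1 n, 0 < lam i) : shiftedCount (n + 1) lam = shiftedCount n lam := by
  have hn : n + 1 ∉ Finset.Icc 1 n := by simp
  have e : Finset.Icc 1 (n + 1) = insert (n + 1) (Finset.Icc 1 n) := by
    ext; simp; omega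
  rw [shiftedCount, shiftedCount, e, Finset.sum_insert hn, Finset.prod_insert hn,
    pairProd_insert hn, h, Finset.prod_eq_one (s := Finset.Icc 1 n)
      (f := fun j => |((0 : ℕ) : ℝ) - lam j| / (((0 : ℕ) : ℝ) + lam j))]
  · simp
  · intro j hj
    have : (0 : ℝ) < lam j := by exact_mod_cast hpos j hj
    rw [Nat.cast_zero, zero_sub, abs_neg, zero_add, abs_of_pos this, div_self this.ne']

/-- The product formula for the number of standard tableaux of shifted shape. -/
theorem ncard_labellings_shiftedDiagram {n : ℕ} {lam : ℕ → ℕ}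
    (hlam : StrictAntiOn lam (Finset.Icc 1 n)) :
    ((labellings (shiftedDiagram n lam)).ncard : ℝ) = shiftedCount n lam := by
  -- Removing a cell lowers the sum, while dropping an empty last row lowers only `n`; the measure
  -- has to see both.
  induction hm : n + ∑ i ∈ Finset.Icc 1 n, lam i using Nat.strong_induction_on
    generalizing n lam with
  | _ m ih =>
  subst hm
  rcases n with _ | n
  · have : shiftedDiagram 0 lam = ∅ := by simp [shiftedDiagram]
    rw [this, labellings_empty]
    simp [shiftedCount, pairProd]
  have hsub : (Finset.Icc 1 n : Set ℕ) ⊆ Finset.Icc 1 (n + 1) := by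
    intro i hi
    simp only [Finset.coe_Icc, Set.mem_Icc] at hi ⊢
    omega
  have hlast : ∀ i ∈ Finset.Icc 1 n, lam (n + 1) < lam i := by
    intro i hi
    refine hlam (hsub hi) (by simp) ?_
    have := Finset.mem_Icc.1 hi
    omega
  rcases Nat.eq_zero_or_pos (lam (n + 1)) with h0 | h0
  · rw [shiftedDiagram_succ_of_eq_zero h0, shiftedCount_succ_of_eq_zero h0 fun i hi =>
      (Nat.zero_le _).trans_lt (hlast i hi)]
    refine ih _ ?_ (hlam.mono hsub) rfl
    rw [Finset.sum_Icc_succ_top (by omega)]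
    omega
  · have hpos : ∀ i ∈ Finset.Icc 1 (n + 1), 0 < lam i := by
      intro i hi
      rcases Nat.lt_or_ge n i with h | h
      · have := Finset.mem_Icc.1 hi
        rwa [show i = n + 1 by omega]
      · exact h0.trans (hlast i (Finset.mem_Icc.2 ⟨(Finset.mem_Icc.1 hi).1, h⟩))
    have hN : (0 : ℝ) < (∑ i ∈ Finset.Icc 1 (n + 1), lam i : ℕ) := by
      exact_mod_cast Finset.sum_pos hpos ⟨1, by simp⟩
    rw [ncard_labellings_eq_sum_rowEnd n.succ_pos hpos, Nat.cast_sum]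
    refine mul_right_cancel₀ hN.ne' ?_
    rw [Finset.sum_mul]
    have hx : Set.InjOn (fun i => (lam i : ℝ)) (Finset.Icc 1 (n + 1)) :=
      Nat.cast_injective.comp_injOn hlam.injOn
    have hsum := sum_rowWeight hx fun i hi => by exact_mod_cast hpos i hi
    rw [Nat.cast_sum, ← hsum, Finset.mul_sum]
    refine Finset.sum_congr rfl fun i hi => ?_
    rw [← shiftedCount_update hlam.injOn hpos hi, hsum, Nat.cast_sum,
      ncard_labellingsMaxAt_rowEnd hlam hpos (fun mu hmu hlt => ih _ (by omega) hmu rfl) hi]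

theorem shiftedCount_pos {n : ℕ} {lam : ℕ → ℕ} (hinj : Set.InjOn lam (Finset.Icc 1 n))
    (hpos : ∀ i ∈ Finset.Icc 1 n, 0 < lam i) : 0 < shiftedCount n lam := by
  refine mul_pos (div_pos (by positivity) (Finset.prod_pos fun i _ => by positivity))
    (Finset.prod_pos fun i hi => Finset.prod_pos fun j hj => ?_)
  split_ifs with h
  · have h1 : (0 : ℝ) < lam i := by exact_mod_cast hpos i hi
    have h2 : (0 : ℝ) < lam j := by exact_mod_cast hpos j hj
    have h3 : (lam i : ℝ) - lam j ≠ 0 := fun h' =>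
      h.ne (hinj hi hj (by exact_mod_cast sub_eq_zero.1 h'))
    positivity
  · exact one_pos

/-- The proportion of standard tableaux of shifted shape `lam` whose maximal label is in row
`i`. -/
theorem ncard_labellingsMaxAt_div {n : ℕ} {lam : ℕ → ℕ}
    (hlam : StrictAntiOn lam (Finset.Icc 1 n)) (hpos : ∀ i ∈ Finset.Icc 1 n, 0 < lam i)
    {i : ℕ} (hi : i ∈ Finset.Icc 1 n) :
    ((labellingsMaxAt (shiftedDiagram n lam) (rowEnd lam i)).ncard : ℝ) /
        (labellings (shiftedDiagram n lam)).ncard =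
      rowWeight (Finset.Icc 1 n) (fun i => (lam i : ℝ)) i / (∑ i ∈ Finset.Icc 1 n, lam i : ℕ) := by
  have hN : (0 : ℝ) < (∑ i ∈ Finset.Icc 1 n, lam i : ℕ) := by
    exact_mod_cast Finset.sum_pos hpos ⟨i, hi⟩
  rw [ncard_labellings_shiftedDiagram hlam, ncard_labellingsMaxAt_rowEnd hlam hpos
    (fun mu hmu _ => ncard_labellings_shiftedDiagram hmu) hi,
    div_eq_div_iff (shiftedCount_pos hlam.injOn hpos).ne' hN.ne',
    shiftedCount_update hlam.injOn hpos hi, mul_comm]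

/-! ### Wallis ratios and the row weights of the staircase -/

/-- The normalised central binomial coefficient `∏ (2m - 1) / (2m)` over `1 ≤ m ≤ k`. -/
noncomputable def wallisRatio (k : ℕ) : ℝ :=
  ∏ m ∈ Finset.range k, (2 * m + 1 : ℝ) / (2 * m + 2)

theorem wallisRatio_pos (k : ℕ) : 0 < wallisRatio k :=
  Finset.prod_pos fun m _ => by positivity

theorem wallisRatio_succ (k : ℕ) :
    wallisRatio (k + 1) = wallisRatio k * ((2 * k + 1) / (2 * k + 2)) :=
  Finset.prod_range_succ _ _

theorem wallisRatio_sq_mul (k : ℕ) :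
    wallisRatio k ^ 2 * (2 * k + 1) = (Real.Wallis.W k)⁻¹ := by
  induction k with
  | zero => simp [wallisRatio, Real.Wallis.W]
  | succ k ih =>
    rw [wallisRatio_succ, Real.Wallis.W_succ, mul_inv, ← ih]
    push_cast
    field_simp
    ring

theorem two_div_pi_le_wallisRatio (k : ℕ) :
    2 / Real.pi ≤ wallisRatio k ^ 2 * (2 * k + 1) := by
  rw [wallisRatio_sq_mul, ← inv_div]
  exact inv_anti₀ (Real.Wallis.W_pos k) (Real.Wallis.W_le k)

/-- The sequence increases to its limit `4 / π`: after clearing denominators, the monotonicity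
inequality has a gap of exactly 1. With `4k + 2` in place of `4k + 1` it would decrease to the same
limit, which is the companion bound `two_div_pi_le_wallisRatio`. -/
theorem wallisRatio_le_four_div_pi (k : ℕ) :
    wallisRatio k ^ 2 * (4 * k + 1) ≤ 4 / Real.pi := by
  have hmono : Monotone fun k : ℕ => wallisRatio k ^ 2 * (4 * k + 1) := by
    refine monotone_nat_of_le_succ fun k => ?_
    rw [wallisRatio_succ, mul_pow, mul_assoc]
    refine mul_le_mul_of_nonneg_left ?_ (sq_nonneg _)
    push_cast
    rw [div_pow, div_mul_eq_mul_div, le_div_iff₀ (by positivity)]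
    nlinarith
  have hlim : Filter.Tendsto (fun k : ℕ => wallisRatio k ^ 2 * (4 * k + 1)) Filter.atTop
      (nhds (4 / Real.pi)) := by
    have h1 : Filter.Tendsto (fun k : ℕ => (2 : ℝ) - 1 / (2 * k + 1)) Filter.atTop
        (nhds (2 - 0)) := by
      refine tendsto_const_nhds.sub ?_
      refine tendsto_const_nhds.div_atTop ?_
      exact Filter.tendsto_atTop_add_const_right _ _
        (tendsto_natCast_atTop_atTop.const_mul_atTop two_pos)
    have h2 := h1.mul (Real.Wallis.tendsto_W_nhds_pi_div_two.inv₀ (by positivity))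
    have e : (2 - 0) * (Real.pi / 2)⁻¹ = 4 / Real.pi := by
      rw [inv_div]; ring
    rw [e] at h2
    refine h2.congr fun k => ?_
    rw [← wallisRatio_sq_mul]
    field_simp
    ring
  exact hmono.ge_of_tendsto hlim k

theorem prod_erase_range (f : ℕ → ℝ) (k M : ℕ) :
    ∏ j ∈ (Finset.range (k + 1 + M)).erase k, f j =
      (∏ j ∈ Finset.range k, f j) * ∏ m ∈ Finset.range M, f (k + 1 + m) := by
  have e : (Finset.range (k + 1 + M)).erase k =
      Finset.range k ∪ (Finset.range M).image (fun m => k + 1 + m) := by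
    ext j
    simp only [Finset.mem_erase, Finset.mem_range, Finset.mem_union, Finset.mem_image]
    constructor
    · intro h
      rcases lt_or_gt_of_ne h.1 with h' | h'
      · exact Or.inl h'
      · exact Or.inr ⟨j - (k + 1), by omega, by omega⟩
    · rintro (h | ⟨m, h, rfl⟩) <;> omega
  rw [e, Finset.prod_union, Finset.prod_image fun a _ b _ h => Nat.add_left_cancel h]
  rw [Finset.disjoint_left]
  intro j hj hj'
  obtain ⟨m, -, rfl⟩ := Finset.mem_image.1 hj'
  have := Finset.mem_range.1 hj
  omega

theorem prod_below_eq_wallisRatio (k : ℕ) :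
    ∏ j ∈ Finset.range k, (2 * k - 2 * j - 1 : ℝ) / (2 * k - 2 * j) = wallisRatio k := by
  rw [wallisRatio, ← Finset.prod_range_reflect]
  refine Finset.prod_congr rfl fun j hj => ?_
  have hj' := Finset.mem_range.1 hj
  have e : ((k - 1 - j : ℕ) : ℝ) = k - 1 - j := by
    rw [Nat.cast_sub (by omega), Nat.cast_sub (by omega), Nat.cast_one]
  rw [e]
  congr 1 <;> ring

theorem prod_above_eq_wallisRatio (k M : ℕ) :
    ∏ m ∈ Finset.range M, (2 * k - 2 * (k + 1 + m : ℕ) - 1 : ℝ) / (2 * k - 2 * (k + 1 + m : ℕ)) =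
      (2 * M + 1) * wallisRatio M := by
  induction M with
  | zero => simp [wallisRatio]
  | succ M ih =>
    rw [Finset.prod_range_succ, ih, wallisRatio_succ]
    push_cast
    have e : (2 * k - 2 * (k + 1 + M) - 1 : ℝ) / (2 * k - 2 * (k + 1 + M)) =
        (2 * M + 3) / (2 * M + 2) := by
      rw [← neg_div_neg_eq]
      congr 1 <;> ring
    rw [e]
    ring

theorem prod_shift_eq_wallisRatio (k r : ℕ) :
    ∏ j ∈ Finset.range r, (2 * (k + j) + 2 : ℝ) / (2 * (k + j) + 1) =
      wallisRatio k / wallisRatio (k + r) := by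
  induction r with
  | zero => simp [(wallisRatio_pos k).ne']
  | succ r ih =>
    rw [Finset.prod_range_succ, ih, ← add_assoc, wallisRatio_succ]
    have := (wallisRatio_pos (k + r)).ne'
    push_cast
    field_simp

/-- Each factor splits into a function of `k - j` times a function of `k + j`. The former give
`wallisRatio k` below `k` and `(2M + 1) * wallisRatio M` above it. The latter telescope, apart from
the omitted index `j = k`, which leaves the factor `(4k + 1) / (4k + 2)`. -/
theorem rowWeight_odd (k M : ℕ) :
    rowWeight (Finset.range (k + 1 + M)) (fun j => (2 * j + 1 : ℝ)) k =
      wallisRatio k ^ 2 * (4 * k + 1) * ((2 * M + 1) * wallisRatio M /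
        wallisRatio (k + 1 + M + k)) / 2 := by
  have e : ∀ j : ℕ, ((2 * k + 1 - 1 - (2 * j + 1)) * (2 * k + 1 + (2 * j + 1)) : ℝ) /
      ((2 * k + 1 - (2 * j + 1)) * (2 * k + 1 - 1 + (2 * j + 1))) =
      (2 * k - 2 * j - 1) / (2 * k - 2 * j) * ((2 * (k + j) + 2) / (2 * (k + j) + 1)) := by
    intro j
    rw [div_mul_div_comm]
    congr 1 <;> ring
  have e2 : ∏ m ∈ Finset.range M, (2 * (k + (k + 1 + m : ℕ)) + 2 : ℝ) /
      (2 * (k + (k + 1 + m : ℕ)) + 1) =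
      wallisRatio (k + k + 1) / wallisRatio (k + k + 1 + M) := by
    rw [← prod_shift_eq_wallisRatio]
    refine Finset.prod_congr rfl fun m _ => ?_
    push_cast
    congr 1 <;> ring
  simp only [rowWeight, e]
  rw [Finset.prod_mul_distrib, prod_erase_range, prod_erase_range, prod_below_eq_wallisRatio,
    prod_above_eq_wallisRatio, prod_shift_eq_wallisRatio, e2, wallisRatio_succ,
    show k + k + 1 + M = k + 1 + M + k by ring]
  have h1 := (wallisRatio_pos (k + k)).ne'
  have h2 := (wallisRatio_pos (k + 1 + M + k)).ne'
  push_cast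
  field_simp
  ring

theorem rowWeight_odd_le {n k : ℕ} (hk : k < n) :
    rowWeight (Finset.range n) (fun j => (2 * j + 1 : ℝ)) k ≤
      4 / Real.pi * √((n + k + 1 / 2) * (n - k)) := by
  obtain ⟨M, rfl⟩ : ∃ M, n = k + 1 + M := ⟨n - (k + 1), by omega⟩
  rw [rowWeight_odd]
  set v := wallisRatio (k + 1 + M + k) with hv
  have hvp : 0 < v := wallisRatio_pos _
  have hw := wallisRatio_pos M
  have h1 := wallisRatio_le_four_div_pi M
  have h2 := two_div_pi_le_wallisRatio (k + 1 + M + k)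
  rw [← hv] at h2
  push_cast at h2 ⊢
  -- Here `M + 1 = n - k`. In the square of the quotient the upper bound for `wallisRatio M` meets
  -- the lower bound for `v`, and the powers of `π` cancel.
  have hq : (2 * M + 1) * wallisRatio M / v ≤
      2 * √((k + 1 + M + k + 1 / 2) * (k + 1 + M - k)) := by
    rw [← Real.sqrt_sq (zero_le_two (α := ℝ)), ← Real.sqrt_mul (by positivity),
      Real.sqrt_sq zero_le_two]
    refine Real.le_sqrt_of_sq_le ?_
    rw [div_pow, div_le_iff₀ (by positivity), mul_pow]
    have h3 : wallisRatio M ^ 2 * (4 * M + 1) ≤ 2 * (v ^ 2 * (2 * (k + 1 + M + k) + 1)) := by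
      calc _ ≤ 4 / Real.pi := h1
        _ = 2 * (2 / Real.pi) := by ring
        _ ≤ _ := by linarith
    have h4 : ((2 * M + 1) ^ 2 : ℝ) ≤ (4 * M + 1) * (M + 1) := by
      have : (0 : ℝ) ≤ M := Nat.cast_nonneg M
      nlinarith
    calc ((2 * M + 1) ^ 2 : ℝ) * wallisRatio M ^ 2
        ≤ (4 * M + 1) * (M + 1) * wallisRatio M ^ 2 := by gcongr
      _ = (wallisRatio M ^ 2 * (4 * M + 1)) * (M + 1) := by ring
      _ ≤ 2 * (v ^ 2 * (2 * (k + 1 + M + k) + 1)) * (M + 1) := by gcongr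
      _ = _ := by ring
  have h5 := wallisRatio_le_four_div_pi k
  calc _ ≤ 4 / Real.pi * (2 * √((k + 1 + M + k + 1 / 2) * (k + 1 + M - k))) / 2 := by
        gcongr
    _ = _ := by ring

theorem rowWeight_odd_div_le {n k : ℕ} (hk : k < n) :
    rowWeight (Finset.range n) (fun j => (2 * j + 1 : ℝ)) k / (n : ℝ) ^ 2 ≤
      (4 / Real.pi * √(1 - (k / n : ℝ) ^ 2) + 4 / Real.pi * √(1 / n)) / n := by
  have hn : (0 : ℝ) < n := by exact_mod_cast (Nat.zero_le k).trans_lt hk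
  have hk' : (k : ℝ) < n := by exact_mod_cast hk
  have hk0 : (0 : ℝ) ≤ k := Nat.cast_nonneg k
  have h1 : √((n + k + 1 / 2) * (n - k)) ≤ n * (√(1 - (k / n : ℝ) ^ 2) + √(1 / n)) := by
    calc √((n + k + 1 / 2) * (n - k)) ≤ √(n ^ 2 * (1 - (k / n : ℝ) ^ 2 + 1 / n)) := by
          refine Real.sqrt_le_sqrt ?_
          have : (n : ℝ) ^ 2 * (1 - (k / n : ℝ) ^ 2 + 1 / n) = n ^ 2 - k ^ 2 + n := by
            field_simp
          rw [this]
          nlinarith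
      _ = n * √(1 - (k / n : ℝ) ^ 2 + 1 / n) := by
          rw [Real.sqrt_mul (by positivity), Real.sqrt_sq hn.le]
      _ ≤ _ := by
          gcongr
          -- Subadditivity of the square root isolates the error `√(1 / n)`.
          refine Real.sqrt_le_iff.2 ⟨by positivity, ?_⟩
          have h0 : 0 ≤ 1 - (k / n : ℝ) ^ 2 :=
            sub_nonneg.2 (pow_le_one₀ (by positivity) ((div_le_one hn).2 hk'.le))
          rw [add_sq, Real.sq_sqrt h0, Real.sq_sqrt (by positivity)]
          linarith [mul_nonneg (mul_nonneg zero_le_two (Real.sqrt_nonneg (1 - (k / n : ℝ) ^ 2)))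
            (Real.sqrt_nonneg (1 / (n : ℝ)))]
  rw [sq, ← div_div]
  refine div_le_div_of_nonneg_right ?_ hn.le
  rw [div_le_iff₀ hn]
  calc _ ≤ _ := rowWeight_odd_le hk
    _ ≤ 4 / Real.pi * (n * (√(1 - (k / n : ℝ) ^ 2) + √(1 / n))) := by gcongr
    _ = _ := by ring

/-! ### The exact law of the offset -/

open ProbabilityTheory MeasureTheory

theorem uniformOn_univ_real {Ω : Type*} [MeasurableSpace Ω] [MeasurableSingletonClass Ω]
    [Finite Ω] (s : Set Ω) : (uniformOn (Set.univ : Set Ω)).real s = s.ncard / Nat.card Ω := by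
  cases nonempty_fintype Ω
  rw [measureReal_def, uniformOn_univ, Measure.count_apply_finite _ s.toFinite, ENNReal.toReal_div,
    ENNReal.toReal_natCast, ENNReal.toReal_natCast, Nat.card_eq_fintype_card,
    Set.ncard_eq_toFinset_card]

theorem natCard_standardTableau (D : Finset (ℕ × ℕ)) :
    Nat.card (StandardTableau D) = (labellings D).ncard := by
  rw [← StandardTableau.range_toFun, ← Set.image_univ,
    Set.ncard_image_of_injective _ StandardTableau.toFun_injective, Set.ncard_univ]

theorem toFun_eq_sq_iff {n : ℕ} (hn : 0 < n) (T : StandardTableau (shiftedStaircase n))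
    (c : ℕ × ℕ) : T.toFun c = n ^ 2 ↔ maxCell hn T = c := by
  constructor
  · intro h
    have hc : c ∈ shiftedStaircase n := by
      by_contra hc
      rw [StandardTableau.toFun, dif_neg hc] at h
      exact absurd h (Nat.pow_pos hn).ne
    rw [StandardTableau.toFun_of_mem _ hc] at h
    rw [maxCell]
    have h' : T.1 ⟨c, hc⟩ = ⟨n ^ 2, Finset.mem_Icc.2
        ⟨Nat.pow_pos hn, (card_shiftedStaircase n).ge⟩⟩ := Subtype.ext h
    rw [← h', Equiv.symm_apply_apply]
  · rintro rfl
    have hm : maxCell hn T ∈ shiftedStaircase n := Subtype.property _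
    rw [StandardTableau.toFun_of_mem _ hm]
    simp [maxCell]

/-- Row `n - k` has length `2k + 1` and starts on the diagonal, so it ends in column `n + k`. -/
theorem maxOffset_eq_iff {n k : ℕ} (hk : k < n) (T : StandardTableau (shiftedStaircase n)) :
    maxOffset T = k ↔ T.toFun (rowEnd (fun i => 2 * (n - i) + 1) (n - k)) = n ^ 2 := by
  have hn : 0 < n := (Nat.zero_le k).trans_lt hk
  have h := maxCell_eq hn T
  rw [toFun_eq_sq_iff hn, rowEnd, Prod.ext_iff]
  simp only
  omega

theorem maxOffset_mem {n : ℕ} (hn : 0 < n) (T : StandardTableau (shiftedStaircase n)) :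
    ∃ k < n, maxOffset T = (k : ℕ) := by
  have h := maxCell_eq hn T
  have hm : maxCell hn T ∈ shiftedStaircase n := Subtype.property _
  have hm' := mem_shiftedStaircase.1 hm
  exact ⟨(maxOffset T).toNat, by omega, by omega⟩

theorem strictAntiOn_staircase (n : ℕ) :
    StrictAntiOn (fun i => 2 * (n - i) + 1) (Finset.Icc 1 n : Set ℕ) := by
  intro i hi j hj hij
  simp only [Finset.coe_Icc, Set.mem_Icc] at hi hj ⊢
  omega

theorem sum_staircase (n : ℕ) : ∑ i ∈ Finset.Icc 1 n, (2 * (n - i) + 1) = n ^ 2 := by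
  rw [← card_shiftedStaircase, shiftedStaircase, shiftedDiagram, Finset.card_biUnion]
  · refine Finset.sum_congr rfl fun i _ => ?_
    rw [Finset.card_image_of_injective _ (Prod.mk_right_injective i), Nat.card_Ico]
    omega
  · intro i _ j _ hij
    simp only [Function.onFun]
    rw [Finset.disjoint_left]
    simp only [Finset.mem_image, not_exists, not_and]
    rintro _ ⟨x, -, rfl⟩ y - h
    exact hij (Prod.mk.inj h).1.symm

theorem rowWeight_staircase {n k : ℕ} (hk : k < n) :
    rowWeight (Finset.Icc 1 n) (fun i => ((2 * (n - i) + 1 : ℕ) : ℝ)) (n - k) =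
      rowWeight (Finset.range n) (fun j => (2 * j + 1 : ℝ)) k := by
  have hkk : n - (n - k) = k := by omega
  simp only [rowWeight, hkk]
  push_cast
  congr 1
  refine Finset.prod_nbij' (fun i => n - i) (fun i => n - i) ?_ ?_ ?_ ?_ fun i _ => rfl <;>
    intro i hi <;> simp only [Finset.mem_erase, Finset.mem_Icc, Finset.mem_range] at hi ⊢ <;> omega

instance (D : Finset (ℕ × ℕ)) : MeasurableSingletonClass (StandardTableau D) :=
  ⟨fun _ => trivial⟩

/-- The exact law of the position of the maximal label. -/
theorem uniformOn_maxOffset_eq {n k : ℕ} (hk : k < n) :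
    (uniformOn (Set.univ : Set (StandardTableau (shiftedStaircase n)))).real
      {T | maxOffset T = k} =
      rowWeight (Finset.range n) (fun j => (2 * j + 1 : ℝ)) k / (n : ℝ) ^ 2 := by
  have himage : StandardTableau.toFun '' {T : StandardTableau (shiftedStaircase n) |
      maxOffset T = k} = labellingsMaxAt (shiftedStaircase n)
        (rowEnd (fun i => 2 * (n - i) + 1) (n - k)) := by
    ext f
    rw [labellingsMaxAt, ← StandardTableau.range_toFun, card_shiftedStaircase]
    constructor
    · rintro ⟨T, hT, rfl⟩
      exact ⟨⟨T, rfl⟩, (maxOffset_eq_iff hk T).1 hT⟩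
    · rintro ⟨⟨T, rfl⟩, hT⟩
      exact ⟨T, (maxOffset_eq_iff hk T).2 hT, rfl⟩
  rw [uniformOn_univ_real, natCard_standardTableau,
    ← Set.ncard_image_of_injective _ StandardTableau.toFun_injective, himage, shiftedStaircase,
    ncard_labellingsMaxAt_div (strictAntiOn_staircase n) (fun i _ => Nat.succ_pos _)
      (Finset.mem_Icc.2 ⟨by omega, by omega⟩), sum_staircase, rowWeight_staircase hk,
    Nat.cast_pow]

/-- The product formula is positive. This is what makes the uniform law a probability measure. -/
theorem nonempty_standardTableau (n : ℕ) : Nonempty (StandardTableau (shiftedStaircase n)) := by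
  have h : (0 : ℝ) < (labellings (shiftedStaircase n)).ncard := by
    rw [shiftedStaircase, ncard_labellings_shiftedDiagram (strictAntiOn_staircase n)]
    exact shiftedCount_pos (strictAntiOn_staircase n).injOn fun i _ => Nat.succ_pos _
  rw [← natCard_standardTableau] at h
  exact (Nat.card_pos_iff.1 (by exact_mod_cast h)).1

/-! ### The quarter-circle density and the limit -/

/-- The density of the quarter-circle law. -/
noncomputable def quarterCircle (x : ℝ) : ℝ := 4 / Real.pi * √(1 - x ^ 2)

theorem continuous_quarterCircle : Continuous quarterCircle := by
  unfold quarterCircle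
  fun_prop

theorem quarterCircle_nonneg (x : ℝ) : 0 ≤ quarterCircle x := by
  unfold quarterCircle
  positivity

theorem antitoneOn_quarterCircle : AntitoneOn quarterCircle (Set.Ici 0) := by
  intro x hx y _ hxy
  have : 0 ≤ x := hx
  unfold quarterCircle
  gcongr

theorem quarterCircle_le {x : ℝ} : quarterCircle x ≤ 4 / Real.pi := by
  unfold quarterCircle
  refine mul_le_of_le_one_right (by positivity) (Real.sqrt_le_one.2 ?_)
  linarith [sq_nonneg x]

theorem integral_quarterCircle : ∫ x in (0 : ℝ)..1, quarterCircle x = 1 := by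
  have h := integral_sqrt_one_sub_sq
  have hc : Continuous fun x : ℝ => √(1 - x ^ 2) := by fun_prop
  rw [← intervalIntegral.integral_add_adjacent_intervals (b := 0) (hc.intervalIntegrable _ _)
    (hc.intervalIntegrable _ _)] at h
  have h' := intervalIntegral.integral_comp_neg (a := -1) (b := 0) fun x : ℝ => √(1 - x ^ 2)
  simp only [neg_sq, neg_zero, neg_neg] at h'
  simp only [quarterCircle, intervalIntegral.integral_const_mul]
  rw [h'] at h
  have hpi := Real.pi_pos
  rw [div_mul_eq_mul_div, div_eq_one_iff_eq hpi.ne']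
  linarith

/-- Comparison of a Riemann sum of the decreasing density with its integral. -/
theorem sum_quarterCircle_le {n : ℕ} (hn : 0 < n) {a b : ℝ} (ha : 0 ≤ a) (hab : a ≤ b) :
    ∑ k ∈ (Finset.range n).filter fun k : ℕ => a ≤ (k : ℝ) / n ∧ (k : ℝ) / n ≤ b,
      quarterCircle (k / n) / n ≤ (∫ x in a..b, quarterCircle x) + 4 / Real.pi / n := by
  have hn' : (0 : ℝ) < n := by exact_mod_cast hn
  have hint : 0 ≤ ∫ x in a..b, quarterCircle x :=
    intervalIntegral.integral_nonneg hab fun x _ => quarterCircle_nonneg x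
  set p := ⌈a * n⌉₊ with hp
  set q := ⌊b * n⌋₊ with hq
  have hsub : ((Finset.range n).filter fun k : ℕ => a ≤ (k : ℝ) / n ∧ (k : ℝ) / n ≤ b) ⊆
      Finset.Icc p q := by
    intro k hk
    obtain ⟨-, h1, h2⟩ := Finset.mem_filter.1 hk
    rw [le_div_iff₀ hn'] at h1
    rw [div_le_iff₀ hn'] at h2
    exact Finset.mem_Icc.2 ⟨Nat.ceil_le.2 h1, Nat.le_floor h2⟩
  refine (Finset.sum_le_sum_of_subset_of_nonneg hsub fun k _ _ =>
    div_nonneg (quarterCircle_nonneg _) hn'.le).trans ?_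
  rcases lt_or_ge q p with hqp | hpq
  · rw [Finset.Icc_eq_empty (by omega), Finset.sum_empty]
    positivity
  have hanti : AntitoneOn (fun x : ℝ => quarterCircle (x / n)) (Set.Icc (p : ℝ) q) := by
    intro x hx y hy hxy
    have hx0 : 0 ≤ x := (Nat.cast_nonneg p).trans hx.1
    exact antitoneOn_quarterCircle (div_nonneg hx0 hn'.le)
      (div_nonneg (hx0.trans hxy) hn'.le) (by gcongr)
  have h1 := hanti.sum_le_integral_Ico hpq
  rw [intervalIntegral.integral_comp_div _ hn'.ne', smul_eq_mul] at h1
  have hpa : a ≤ (p : ℝ) / n := (le_div_iff₀ hn').2 (Nat.le_ceil _)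
  have hqb : (q : ℝ) / n ≤ b :=
    (div_le_iff₀ hn').2 (Nat.floor_le (mul_nonneg (ha.trans hab) hn'.le))
  have hpq' : (p : ℝ) / n ≤ (q : ℝ) / n := by gcongr
  have h2 : ∫ x in (p / n : ℝ)..(q / n : ℝ), quarterCircle x ≤ ∫ x in a..b, quarterCircle x :=
    intervalIntegral.integral_mono_interval hpa hpq' hqb
      (Filter.Eventually.of_forall quarterCircle_nonneg)
      (continuous_quarterCircle.intervalIntegrable _ _)
  -- The term `k = p` is split off and costs at most `4 / π / n`. Every later term is at most the
  -- integral over the interval to its left, since the density decreases.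
  rw [← Finset.sum_div, ← Finset.add_sum_Ioc_eq_sum_Icc hpq, add_div, add_comm]
  refine add_le_add ?_ (by gcongr; exact quarterCircle_le)
  rw [div_le_iff₀ hn']
  calc ∑ k ∈ Finset.Ioc p q, quarterCircle (k / n)
      = ∑ k ∈ Finset.Ico p q, quarterCircle ((k + 1 : ℕ) / n) := by
        rw [Finset.sum_Ico_add' (fun k : ℕ => quarterCircle (k / n)) p q 1]
        congr 1
        ext k
        simp only [Finset.mem_Ioc, Finset.mem_Ico]
        omega
    _ ≤ _ := h1
    _ ≤ _ := by rw [mul_comm]; gcongr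

/-- The probability that the position of the maximal label is in `[a, b]`. -/
noncomputable def offsetProb (n : ℕ) (a b : ℝ) : ℝ :=
  (uniformOn (Set.univ : Set (StandardTableau (shiftedStaircase n)))).real
    {T | a ≤ (maxOffset T : ℝ) / (n : ℝ) ∧ (maxOffset T : ℝ) / (n : ℝ) ≤ b}

/-- The error term of the approximation of `offsetProb` by the quarter-circle law. -/
noncomputable def offsetError (n : ℕ) : ℝ := 4 / Real.pi * √(1 / n) + 4 / Real.pi / n

/-- At most `n` values of the offset contribute, each with error `4 / π * √(1 / n) / n`; the Riemann
sum adds `4 / π / n`. -/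
theorem offsetProb_le {n : ℕ} (hn : 0 < n) {a b : ℝ} (ha : 0 ≤ a) (hab : a ≤ b) :
    offsetProb n a b ≤ (∫ x in a..b, quarterCircle x) + offsetError n := by
  have hn' : (0 : ℝ) < n := by exact_mod_cast hn
  set K := (Finset.range n).filter fun k : ℕ => a ≤ (k : ℝ) / n ∧ (k : ℝ) / n ≤ b with hK
  have hsub : {T : StandardTableau (shiftedStaircase n) |
      a ≤ (maxOffset T : ℝ) / (n : ℝ) ∧ (maxOffset T : ℝ) / (n : ℝ) ≤ b} ⊆
      ⋃ k ∈ K, {T | maxOffset T = (k : ℕ)} := by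
    intro T hT
    obtain ⟨k, hk, hTk⟩ := maxOffset_mem hn T
    simp only [Set.mem_ofPred_eq, hTk, Int.cast_natCast] at hT
    exact Set.mem_biUnion (Finset.mem_filter.2 ⟨Finset.mem_range.2 hk, hT⟩) hTk
  have hcard : (K.card : ℝ) ≤ n := by
    exact_mod_cast (Finset.card_filter_le _ _).trans (Finset.card_range n).le
  calc offsetProb n a b
      ≤ ∑ k ∈ K, (uniformOn (Set.univ : Set (StandardTableau (shiftedStaircase n)))).real
          {T | maxOffset T = (k : ℕ)} :=
        (measureReal_mono hsub (measure_ne_top _ _)).trans (measureReal_biUnion_finset_le _ _)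
    _ ≤ ∑ k ∈ K, (quarterCircle (k / n) / n + 4 / Real.pi * √(1 / n) / n) := by
        refine Finset.sum_le_sum fun k hk => ?_
        have hk' := Finset.mem_range.1 (Finset.mem_filter.1 hk).1
        rw [uniformOn_maxOffset_eq hk', ← add_div]
        exact rowWeight_odd_div_le hk'
    _ = (∑ k ∈ K, quarterCircle (k / n) / n) + K.card * (4 / Real.pi * √(1 / n) / n) := by
        rw [Finset.sum_add_distrib, Finset.sum_const, nsmul_eq_mul]
    _ ≤ ((∫ x in a..b, quarterCircle x) + 4 / Real.pi / n) +
          n * (4 / Real.pi * √(1 / n) / n) := by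
        gcongr
        exact sum_quarterCircle_le hn ha hab
    _ = _ := by
        rw [offsetError, mul_div_cancel₀ _ hn'.ne']
        ring

/-- The intervals `[0, a]`, `[a, b]`, `[b, 1]` cover all values of `S / n`, so their probabilities
sum to at least 1, whereas the integrals of the density over them sum to exactly 1. The upper bounds
on the two outer intervals cost one error term each. Overlap at `a` and `b` is harmless, as only
subadditivity is used. -/
theorem le_offsetProb {n : ℕ} (hn : 0 < n) {a b : ℝ} (ha : 0 ≤ a) (hab : a ≤ b) (hb : b ≤ 1) :
    (∫ x in a..b, quarterCircle x) - 2 * offsetError n ≤ offsetProb n a b := by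
  have hn' : (0 : ℝ) < n := by exact_mod_cast hn
  have := nonempty_standardTableau n
  have : IsProbabilityMeasure (uniformOn (Set.univ : Set (StandardTableau (shiftedStaircase n)))) :=
    isProbabilityMeasure_uniformOn Set.finite_univ Set.univ_nonempty
  have hone : 1 ≤ offsetProb n a b + (offsetProb n 0 a + offsetProb n b 1) := by
    refine (probReal_univ (μ := uniformOn
      (Set.univ : Set (StandardTableau (shiftedStaircase n))))).ge.trans ?_
    refine le_trans (measureReal_mono (fun T _ => ?_) (measure_ne_top _ _))
      ((measureReal_union_le _ _).trans (add_le_add_right (measureReal_union_le _ _) _))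
    obtain ⟨k, hk, hTk⟩ := maxOffset_mem hn T
    have h0 : 0 ≤ (maxOffset T : ℝ) / n := by
      rw [hTk]
      positivity
    have h1 : (maxOffset T : ℝ) / n ≤ 1 := by
      rw [hTk, div_le_one hn']
      exact_mod_cast hk.le
    rcases le_total a ((maxOffset T : ℝ) / n) with h | h
    · rcases le_total ((maxOffset T : ℝ) / n) b with h' | h'
      · exact Or.inl ⟨h, h'⟩
      · exact Or.inr (Or.inr ⟨h', h1⟩)
    · exact Or.inr (Or.inl ⟨h0, h⟩)
  have hi : ∀ u v : ℝ, IntervalIntegrable quarterCircle volume u v := fun u v =>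
    continuous_quarterCircle.intervalIntegrable u v
  have e1 := intervalIntegral.integral_add_adjacent_intervals (hi 0 a) (hi a b)
  have e2 := intervalIntegral.integral_add_adjacent_intervals (hi 0 b) (hi b 1)
  rw [integral_quarterCircle] at e2
  linarith [offsetProb_le hn le_rfl ha, offsetProb_le hn (ha.trans hab) hb]

theorem tendsto_offsetError : Filter.Tendsto offsetError Filter.atTop (nhds 0) := by
  have h : Filter.Tendsto (fun n : ℕ => (1 : ℝ) / n) Filter.atTop (nhds 0) :=
    tendsto_one_div_atTop_nhds_zero_nat
  have h1 := (h.sqrt.const_mul (4 / Real.pi)).add (h.const_mul (4 / Real.pi))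
  simp only [Real.sqrt_zero, mul_zero, add_zero] at h1
  refine h1.congr fun n => ?_
  rw [offsetError, mul_one_div]

theorem theorem1 (a b : ℝ) (ha : 0 ≤ a) (hab : a ≤ b) (hb : b ≤ 1) :
    Filter.Tendsto
      (fun n : ℕ =>
        (ProbabilityTheory.uniformOn
          (Set.univ : Set (StandardTableau (shiftedStaircase n)))).real
          {T | a ≤ (maxOffset T : ℝ) / (n : ℝ) ∧ (maxOffset T : ℝ) / (n : ℝ) ≤ b})
      Filter.atTop
      (nhds (∫ x in a..b, 4 / Real.pi * Real.sqrt (1 - x ^ 2))) := by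
  have hlow : Filter.Tendsto (fun n => (∫ x in a..b, quarterCircle x) - 2 * offsetError n)
      Filter.atTop (nhds (∫ x in a..b, quarterCircle x)) := by
    simpa using tendsto_const_nhds.sub (tendsto_offsetError.const_mul 2)
  have hup : Filter.Tendsto (fun n => (∫ x in a..b, quarterCircle x) + offsetError n)
      Filter.atTop (nhds (∫ x in a..b, quarterCircle x)) := by
    simpa using tendsto_const_nhds.add tendsto_offsetError
  refine tendsto_of_tendsto_of_tendsto_of_le_of_le' hlow hup ?_ ?_
  · filter_upwards [Filter.eventually_gt_atTop 0] with n hn using le_offsetProb hn ha hab hb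
  · filter_upwards [Filter.eventually_gt_atTop 0] with n hn using offsetProb_le hn ha hab
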